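/- Let $\Theta\subseteq\mathbb R^k$ and $\Lambda\subseteq\mathbb R^m$ be open, let $\{f_\theta\}_{\theta\in\Theta}$ be Lebesgue densities on $\mathbb R$, and let $\{h_\eta\}_{\eta\in\Lambda}$ be Lebesgue densities on $\mathbb R$ with mean zero and finite positive variance. Put $$g(y;(\theta,\eta))=\int_{\mathbb R} f_\theta(s)\,h_\eta(y-s)\,ds ,$$ let $G_{\theta,\eta}$ be the probability measure with density $g(\cdot;(\theta,\eta))$, and let $G^n_{\theta,\eta}$ be its $n$-fold product. Define the score functions $$\dot l_\theta=\frac{\nabla_\theta\, g(\cdot;(\theta,\eta))}{g(\cdot;(\theta,\eta))}\,1_{[g>0]},\qquad \dot l_\eta=\frac{\nabla_\eta\, g(\cdot;(\theta,\eta))}{g(\cdot;(\theta,\eta))}\,1_{[g>0]},\qquad \dot l_{\theta,\eta}=(\dot l_\theta,\dot l_\eta),$$ viewed as column vectors, and the Fisher information $I(\theta,\eta)=\int \dot l_{\theta,\eta}\,\dot l_{\theta,\eta}^{\,T}\,dG_{\theta,\eta}$, with blocks $I_{11},I_{12},I_{21},I_{22}$ corresponding to $\theta$ and $\eta$. Assume: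 * **A1**: for Lebesgue-almost every $y$, the map $(\theta,\eta)\mapsto g(y;(\theta,\eta))$ is continuously differentiable on $\Theta\times\Lambda$; * **A2**: $|\dot l_{\theta,\eta}|\in L_2(G_{\theta,\eta})$ for all $(\theta,\eta)\in\Theta\times\Lambda$; * **A3**: $I(\theta,\eta)$ is nonsingular for all $(\theta,\eta)\in\Theta\times\Lambda$ and continuous in $(\theta,\eta)$. Let $(\theta_0,\eta_0)\in\Theta\times\Lambda$, and define the efficient score and the efficient information for $\theta$ at $(\theta_0,\eta_0)$ by $$l^*_{\theta_0}=\dot l_{\theta_0}-I_{12}(\theta_0,\eta_0)\,I_{22}(\theta_0,\eta_0)^{-1}\,\dot l_{\eta_0},\qquad I^*_{\theta_0}=\int l^*_{\theta_0}\,l_{\theta_0}^{*\,T}\,dG_{\theta_0,\eta_0}.$$ For each $n$ let $l^*_j=l^*_{j,n}(Y_1,\dots,Y_n)\in\mathbb R^k$ $(1\le j\le n)$ and $\widehat L=\widehat L_n(Y_1,\dots,Y_n)\in\mathbb R^{k\times k}$ be measurable functions of the data such that, for every $\varepsilon>0$, as $n\to\infty$, $$G^n_{\theta_0,\eta_0}\Bigl(\tfrac1{\sqrt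 n}\,\Bigl\|\sum_{j=1}^n\bigl(l^*_j-l^*_{\theta_0}(Y_j)\bigr)\Bigr\|\ge\varepsilon\Bigr)\to0 \quad\text{and}\quad G^n_{\theta_0,\eta_0}\bigl(\|\widehat L-(I^*_{\theta_0})^{-1}\|\ge\varepsilon\bigr)\to 0 ,$$ where $\|\cdot\|$ denotes the Euclidean norm of a vector, respectively of a matrix. Suppose that $Y_i=X_i+\varepsilon_i$, $i=1,2,\dots$, where the pairs $(X_i,\varepsilon_i)$ are independent over $i$, and for each $i$ the variables $X_i$ and $\varepsilon_i$ are independent with densities $f_{\theta_0}$ and $h_{\eta_0}$ respectively (that is, the null hypothesis $H_0:\theta=\theta_0$ holds and $\eta_0$ is the true nuisance parameter). Then the efficient score statistic $$W_k=\Bigl\{\tfrac1{\sqrt n}\sum_{j=1}^n l^*_j\Bigr\}^{T}\,\widehat L\,\Bigl\{\tfrac1{\sqrt n}\sum_{j=1}^n l^*_j\Bigr\}$$ converges in distribution, as $n\to\infty$, to the central chi-square distribution $\chi^2_k$ with $k$ degrees of freedom. -/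

import Mathlib

open MeasureTheory ProbabilityTheory Filter Topology

noncomputable section

namespace Deconvolution

/-- `p` is a probability density on `ℝ` with respect to Lebesgue measure. -/
structure IsDensity (p : ℝ → ℝ) : Prop where
  measurable : Measurable p
  nonneg : ∀ x, 0 ≤ p x
  integrable : Integrable p
  integral_eq_one : ∫ x, p x = 1

/-- The measure on `ℝ` with Lebesgue density `p`. -/
def densityMeasure (p : ℝ → ℝ) : Measure ℝ :=
  volume.withDensity fun x => ENNReal.ofReal (p x)

/-- The composite deconvolution model: one observes `Y = X + ε` where `X` has a density `f θ`,
`θ ∈ Θ ⊆ ℝᵏ`, and the independent noise `ε` has a density `h η`, `η ∈ Λ ⊆ ℝᵐ`, with mean zero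
and finite positive variance. The parameter sets are open, so that derivatives with
respect to the parameters make sense. -/
structure Model (k m : ℕ) where
  /-- the set of values of the parameter of interest -/
  Θ : Set (EuclideanSpace ℝ (Fin k))
  /-- the set of values of the nuisance parameter -/
  Λ : Set (EuclideanSpace ℝ (Fin m))
  /-- the densities of the signal `X` -/
  f : EuclideanSpace ℝ (Fin k) → ℝ → ℝ
  /-- the densities of the noise `ε` -/
  h : EuclideanSpace ℝ (Fin m) → ℝ → ℝ
  isOpen_Θ : IsOpen Θ
  isOpen_Λ : IsOpen Λ
  isDensity_f : ∀ θ ∈ Θ, IsDensity (f θ)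
  isDensity_h : ∀ η ∈ Λ, IsDensity (h η)
  noise_mean : ∀ η ∈ Λ, ∫ x, x * h η x = 0
  noise_sq_integrable : ∀ η ∈ Λ, Integrable fun x => x ^ 2 * h η x
  noise_var_pos : ∀ η ∈ Λ, 0 < ∫ x, x ^ 2 * h η x

namespace Model

variable {k m : ℕ}

/-- The density `g(y; (θ, η)) = ∫ f_θ(s) h_η(y - s) ds` of an observation `Y`. -/
def g (M : Model k m) (θ : EuclideanSpace ℝ (Fin k)) (η : EuclideanSpace ℝ (Fin m))
    (y : ℝ) : ℝ :=
  ∫ s, M.f θ s * M.h η (y - s)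

/-- The distribution `G_{θ, η}` of an observation `Y`. -/
def G (M : Model k m) (θ : EuclideanSpace ℝ (Fin k)) (η : EuclideanSpace ℝ (Fin m)) :
    Measure ℝ :=
  densityMeasure (M.g θ η)

/-- The score function for `θ` at `(θ, η)`. -/
def scoreθ (M : Model k m) (θ : EuclideanSpace ℝ (Fin k)) (η : EuclideanSpace ℝ (Fin m))
    (y : ℝ) : EuclideanSpace ℝ (Fin k) :=
  {y | 0 < M.g θ η y}.indicator
    (fun y => (M.g θ η y)⁻¹ • gradient (fun θ' => M.g θ' η y) θ) y

/-- The score function for `η` at `(θ, η)`. -/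
def scoreη (M : Model k m) (θ : EuclideanSpace ℝ (Fin k)) (η : EuclideanSpace ℝ (Fin m))
    (y : ℝ) : EuclideanSpace ℝ (Fin m) :=
  {y | 0 < M.g θ η y}.indicator
    (fun y => (M.g θ η y)⁻¹ • gradient (fun η' => M.g θ η' y) η) y

/-- The score function `(l̇_θ, l̇_η)` for the full parameter `(θ, η)`. -/
def score (M : Model k m) (θ : EuclideanSpace ℝ (Fin k)) (η : EuclideanSpace ℝ (Fin m))
    (y : ℝ) : EuclideanSpace ℝ (Fin k ⊕ Fin m) :=
  WithLp.toLp 2 (Sum.elim (M.scoreθ θ η y) (M.scoreη θ η y))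

/-- The Fisher information matrix `I(θ, η)` of the full parameter. -/
def fisherInfo (M : Model k m) (θ : EuclideanSpace ℝ (Fin k))
    (η : EuclideanSpace ℝ (Fin m)) : Matrix (Fin k ⊕ Fin m) (Fin k ⊕ Fin m) ℝ :=
  Matrix.of fun a b => ∫ y, M.score θ η y a * M.score θ η y b ∂(M.G θ η)

/-- The regularity conditions: `A1` the densities are continuously differentiable in the parameter,
`A2` the scores are square integrable, `A3` the Fisher information is nonsingular and continuous. -/
structure IsRegular (M : Model k m) : Prop where
  A1 : ∀ᵐ y : ℝ, ContDiffOn ℝ 1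
    (fun p : EuclideanSpace ℝ (Fin k) × EuclideanSpace ℝ (Fin m) => M.g p.1 p.2 y)
    (M.Θ ×ˢ M.Λ)
  A2 : ∀ θ ∈ M.Θ, ∀ η ∈ M.Λ, MemLp (M.score θ η) 2 (M.G θ η)
  A3_nonsingular : ∀ θ ∈ M.Θ, ∀ η ∈ M.Λ, IsUnit (M.fisherInfo θ η).det
  A3_continuous : ContinuousOn
    (fun p : EuclideanSpace ℝ (Fin k) × EuclideanSpace ℝ (Fin m) => M.fisherInfo p.1 p.2)
    (M.Θ ×ˢ M.Λ)

/-- The efficient score function `l* = l̇_θ - I₁₂ I₂₂⁻¹ l̇_η` for `θ`. -/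
def effScore (M : Model k m) (θ : EuclideanSpace ℝ (Fin k)) (η : EuclideanSpace ℝ (Fin m))
    (y : ℝ) : EuclideanSpace ℝ (Fin k) :=
  M.scoreθ θ η y - WithLp.toLp 2 (Matrix.mulVec
    ((M.fisherInfo θ η).toBlocks₁₂ * ((M.fisherInfo θ η).toBlocks₂₂)⁻¹)
    (WithLp.ofLp (M.scoreη θ η y)))

/-- The efficient Fisher information matrix for `θ`. -/
def effInfo (M : Model k m) (θ : EuclideanSpace ℝ (Fin k)) (η : EuclideanSpace ℝ (Fin m)) :
    Matrix (Fin k) (Fin k) ℝ :=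
  Matrix.of fun a b => ∫ y, M.effScore θ η y a * M.effScore θ η y b ∂(M.G θ η)

/-- The joint distribution `Gⁿ_{θ, η}` of `n` independent observations. -/
def Gn (M : Model k m) (θ : EuclideanSpace ℝ (Fin k)) (η : EuclideanSpace ℝ (Fin m))
    (n : ℕ) : Measure (Fin n → ℝ) :=
  Measure.pi fun _ => M.G θ η

/-- The estimated scores `lhat n y j`, functions of the data `y = (y_1, …, y_n)`, are sufficiently
good at `(θ, η)`: the normalized sum `n^{-1/2} ∑ⱼ (lhat n y j - l*(y_j))` tends to zero in
`Gⁿ_{θ, η}`-probability. -/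
def IsSufficientlyGood (M : Model k m) (θ : EuclideanSpace ℝ (Fin k))
    (η : EuclideanSpace ℝ (Fin m))
    (lhat : (n : ℕ) → (Fin n → ℝ) → Fin n → EuclideanSpace ℝ (Fin k)) : Prop :=
  ∀ ε : ℝ, 0 < ε → Tendsto
    (fun n : ℕ => M.Gn θ η n
      {y | ε ≤ (1 / √(n : ℝ)) * ‖∑ j, (lhat n y j - M.effScore θ η (y j))‖})
    atTop (𝓝 0)

/-- `Lhat n`, a function of `n` observations, is a consistent estimate of the inverse efficient
information at `(θ, η)` (in the Euclidean matrix norm). -/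
def IsConsistent (M : Model k m) (θ : EuclideanSpace ℝ (Fin k))
    (η : EuclideanSpace ℝ (Fin m))
    (Lhat : (n : ℕ) → (Fin n → ℝ) → Matrix (Fin k) (Fin k) ℝ) : Prop :=
  ∀ ε : ℝ, 0 < ε → Tendsto
    (fun n : ℕ => M.Gn θ η n
      {y | ε ≤ √(∑ a, ∑ b, (Lhat n y a b - (M.effInfo θ η)⁻¹ a b) ^ 2)})
    atTop (𝓝 0)

end Model

/-- The efficient score test statistic
`W_k = {n^{-1/2} ∑ⱼ lhatⱼ} Lhat {n^{-1/2} ∑ⱼ lhatⱼ}ᵀ` computed from the data `y`. -/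
def effScoreStatistic {k : ℕ}
    (lhat : (n : ℕ) → (Fin n → ℝ) → Fin n → EuclideanSpace ℝ (Fin k))
    (Lhat : (n : ℕ) → (Fin n → ℝ) → Matrix (Fin k) (Fin k) ℝ)
    (n : ℕ) (y : Fin n → ℝ) : ℝ :=
  dotProduct (WithLp.ofLp ((1 / √(n : ℝ)) • ∑ j, lhat n y j))
    (Matrix.mulVec (Lhat n y) (WithLp.ofLp ((1 / √(n : ℝ)) • ∑ j, lhat n y j)))

/-- The central chi-square distribution with `k` degrees of freedom: the law of the sum of
squares of `k` independent standard normal variables. -/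
def chiSquare (k : ℕ) : Measure ℝ :=
  (Measure.pi fun _ : Fin k => gaussianReal 0 1).map fun z => ∑ i, z i ^ 2

instance (k : ℕ) : IsProbabilityMeasure (chiSquare k) :=
  Measure.isProbabilityMeasure_map
    (show Measurable fun z : Fin k → ℝ => ∑ i, z i ^ 2 by fun_prop).aemeasurable

end Deconvolution

end

/-!
The score has mean zero because the identity `∫ g = 1` may be differentiated along a path `q` of
densities: by the inequality of arithmetic and geometric means `|q'| ≤ (q'² / q + q) / 2`, and the
integral of this bound is a function of the Fisher information, hence continuous, so that Pratt's
form of dominated convergence makes `∫ q'` continuous, and integrating it along the path gives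
`∫ q' = 0`. The efficient score is the image of the score under a linear map of full rank, so it is
centred and its second moments form a positive definite matrix `S`. By the central limit theorem
and Slutsky's theorem the statistic then converges to `zᵀ S⁻¹ z` with `z ∼ N(0, S)`; for
`z = S^{1/2} w` this is the sum of squares `wᵀ w` of independent standard normal variables.
-/

namespace EfficientScoreTest

open scoped RealInnerProductSpace MatrixOrder Matrix

section CentralLimit

variable {Ω Ω' E : Type*} {mΩ : MeasurableSpace Ω} {mΩ' : MeasurableSpace Ω'} {P : Measure Ω}
  {P' : Measure Ω'}

lemma charFun_map_eq_charFun_map_inner [NormedAddCommGroup E] [InnerProductSpace ℝ E]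
    [MeasurableSpace E] [BorelSpace E] [SecondCountableTopology E] {X : Ω → E}
    (hX : AEMeasurable X P) (t : E) :
    charFun (P.map X) t = charFun (P.map fun ω => ⟪t, X ω⟫) 1 := by
  rw [charFun_eq_charFunDual_toDualMap, charFunDual_eq_charFun_map_one,
    AEMeasurable.map_map_of_aemeasurable (by fun_prop) hX]
  rfl

variable [IsProbabilityMeasure P] [IsProbabilityMeasure P']

lemma tendstoInDistribution_congr_law {ι Ω'' : Type*} {mΩ'' : MeasurableSpace Ω''}
    {P'' : Measure Ω''} [IsProbabilityMeasure P''] [TopologicalSpace E] [MeasurableSpace E]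
    [OpensMeasurableSpace E] {l : Filter ι} {X : ι → Ω → E} {Z : Ω' → E} {Z' : Ω'' → E}
    (h : TendstoInDistribution X l Z (fun _ => P) P') (hZ' : AEMeasurable Z' P'')
    (hlaw : P'.map Z = P''.map Z') : TendstoInDistribution X l Z' (fun _ => P) P'' where
  forall_aemeasurable := h.forall_aemeasurable
  aemeasurable_limit := hZ'
  tendsto := by simpa only [hlaw] using h.tendsto

variable [NormedAddCommGroup E] [InnerProductSpace ℝ E] [MeasurableSpace E] [BorelSpace E]
  [FiniteDimensional ℝ E]

/-- By Lévy's continuity theorem it suffices to follow the characteristic function at each `t`,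
which only sees the real random variables `⟪t, X i⟫`. -/
theorem tendstoInDistribution_inv_sqrt_smul_sum_sub {ν : Measure E} [IsGaussian ν] {Z : Ω' → E}
    (hZ : HasLaw Z ν P') (hν : ν[id] = 0) {X : ℕ → Ω → E} (hX : MemLp (X 0) 2 P)
    (hcov : covarianceBilin ν = covarianceBilin (P.map (X 0))) (hindep : iIndepFun X P)
    (hident : ∀ i, IdentDistrib (X i) (X 0) P P) :
    TendstoInDistribution
      (fun (n : ℕ) ω => (√n)⁻¹ • (∑ i ∈ Finset.range n, X i ω - n • P[X 0])) atTop Z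
      (fun _ => P) P' := by
  have hXm i : AEMeasurable (X i) P := (hident i).aemeasurable_fst
  have hsum (n : ℕ) :
      AEMeasurable (fun ω => (√n)⁻¹ • (∑ i ∈ Finset.range n, X i ω - n • P[X 0])) P := by
    fun_prop
  refine ⟨hsum, hZ.aemeasurable, ProbabilityMeasure.tendsto_iff_tendsto_charFun.2 fun t => ?_⟩
  have hinner : Measurable fun x : E => ⟪t, x⟫ := by fun_prop
  have hvar : Var[fun ω => ⟪t, X 0 ω⟫; P] = covarianceBilin ν t t := by
    have hlaw : MemLp id 2 (P.map (X 0)) :=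
      (memLp_map_measure_iff aestronglyMeasurable_id (hXm 0)).2 hX
    rw [hcov, covarianceBilin_self hlaw, variance_map (by fun_prop) (hXm 0)]
    rfl
  have hreal := (tendstoInDistribution_inv_sqrt_mul_sum_sub (P := P)
    (X := fun i ω => ⟪t, X i ω⟫) (Y := id) HasLaw.id (hX.const_inner t)
    (hindep.comp (fun _ x => ⟪t, x⟫) fun _ => hinner)
    fun i => (hident i).comp hinner).tendsto
  have hlim := ProbabilityMeasure.tendsto_iff_tendsto_charFun.1 hreal 1
  simp only [ProbabilityMeasure.coe_mk, hZ.map_eq, Measure.map_id, charFun_gaussianReal, hvar,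
    Real.coe_toNNReal _ (covarianceBilin_self_nonneg t)] at hlim ⊢
  rw [IsGaussian.charFun_eq', hν]
  convert hlim using 2 with n
  · rw [charFun_map_eq_charFun_map_inner (hsum n)]
    congr 3
    ext ω
    simp [inner_smul_right, inner_sub_right, inner_sum, ← Nat.cast_smul_eq_nsmul ℝ n,
      integral_inner (hX.integrable one_le_two)]
  · simp

end CentralLimit

section ChiSquare

lemma dotProduct_inv_mulVec_sqrt_mulVec {ι : Type*} [Fintype ι] [DecidableEq ι]
    {S : Matrix ι ι ℝ} (hS : S.PosDef) (z : ι → ℝ) :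
    (CFC.sqrt S *ᵥ z) ⬝ᵥ S⁻¹ *ᵥ (CFC.sqrt S *ᵥ z) = z ⬝ᵥ z := by
  set R := CFC.sqrt S
  have hRR : R * R = S := CFC.sqrt_mul_sqrt_self _ hS.posSemidef.nonneg
  have hRt : Rᵀ = R := by
    have : IsSelfAdjoint R := (CFC.sqrt_nonneg S).isSelfAdjoint
    simpa [IsSelfAdjoint, Matrix.star_eq_conjTranspose] using this
  have hdet : IsUnit R.det := by
    have := (Matrix.isUnit_iff_isUnit_det _).1 hS.isUnit
    rw [← hRR, Matrix.det_mul] at this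
    exact isUnit_of_mul_isUnit_left this
  have hRSR : R * (S⁻¹ * R) = 1 := by
    rw [← hRR, Matrix.mul_inv_rev, Matrix.mul_assoc, Matrix.nonsing_inv_mul _ hdet,
      Matrix.mul_one, Matrix.mul_nonsing_inv _ hdet]
  calc (R *ᵥ z) ⬝ᵥ S⁻¹ *ᵥ (R *ᵥ z)
    _ = z ⬝ᵥ (R * (S⁻¹ * R)) *ᵥ z := by
      rw [← Matrix.mulVec_mulVec, ← Matrix.mulVec_mulVec, Matrix.dotProduct_mulVec z R,
        ← Matrix.mulVec_transpose, hRt]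
    _ = z ⬝ᵥ z := by rw [hRSR, Matrix.one_mulVec]

variable {k : ℕ} {S : Matrix (Fin k) (Fin k) ℝ}

lemma map_dotProduct_inv_mulVec_multivariateGaussian (hS : S.PosDef) :
    (multivariateGaussian 0 S).map (fun z => z.ofLp ⬝ᵥ S⁻¹ *ᵥ z.ofLp) =
      Deconvolution.chiSquare k := by
  rw [multivariateGaussian, ← map_pi_eq_stdGaussian, Measure.map_map (by fun_prop) (by fun_prop),
    Measure.map_map (by fun_prop) (by fun_prop), Deconvolution.chiSquare]
  congr 1
  ext z
  simpa [dotProduct, pow_two] using dotProduct_inv_mulVec_sqrt_mulVec hS z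

/- Matrices carry no measurable structure, so the random matrices enter through their entries, as
vectors of a Euclidean space. -/
lemma tendstoInDistribution_dotProduct_mulVec_chiSquare (hS : S.PosDef) {Ω : Type*}
    {mΩ : MeasurableSpace Ω} {P : Measure Ω} [IsProbabilityMeasure P]
    {U : ℕ → Ω → EuclideanSpace ℝ (Fin k)} {L : ℕ → Ω → Matrix (Fin k) (Fin k) ℝ}
    (hU : TendstoInDistribution U atTop id (fun _ => P) (multivariateGaussian 0 S))
    (hLm : ∀ n a b, AEMeasurable (fun ω => L n ω a b) P)
    (hL : TendstoInMeasure P (fun n ω => WithLp.toLp 2 fun c : Fin k × Fin k => L n ω c.1 c.2)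
      atTop fun _ => WithLp.toLp 2 fun c : Fin k × Fin k => S⁻¹ c.1 c.2) :
    TendstoInDistribution (fun n ω => (U n ω).ofLp ⬝ᵥ L n ω *ᵥ (U n ω).ofLp) atTop (id : ℝ → ℝ)
      (fun _ => P) (Deconvolution.chiSquare k) := by
  have hLm' n : AEMeasurable
      (fun ω => WithLp.toLp 2 fun c : Fin k × Fin k => L n ω c.1 c.2) P := by
    have := hLm n
    fun_prop
  have hquad : Continuous fun p : EuclideanSpace ℝ (Fin k) × EuclideanSpace ℝ (Fin k × Fin k) =>
      p.1.ofLp ⬝ᵥ (Matrix.of fun a b => p.2.ofLp (a, b)) *ᵥ p.1.ofLp := by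
    simp only [dotProduct, Matrix.mulVec, Matrix.of_apply]
    fun_prop
  have hslutsky := hU.continuous_comp_prodMk_of_tendstoInMeasure_const hquad hL hLm'
  refine tendstoInDistribution_congr_law hslutsky aemeasurable_id ?_
  rw [Measure.map_id, ← map_dotProduct_inv_mulVec_multivariateGaussian hS]
  rfl

end ChiSquare

section DominatedConvergence

variable {𝓨 E ι : Type*} {m𝓨 : MeasurableSpace 𝓨} {μ : Measure 𝓨} {l : Filter ι}
  [l.IsCountablyGenerated] {D : ι → 𝓨 → ℝ} {D₀ : 𝓨 → ℝ}

lemma tendsto_integral_sub_min (hD : ∀ i, Integrable (D i) μ) (hD₀ : Integrable D₀ μ)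
    (hD_nonneg : ∀ i, 0 ≤ᵐ[μ] D i) (hD₀_nonneg : 0 ≤ᵐ[μ] D₀)
    (hmin : ∀ᵐ y ∂μ, Tendsto (fun i => min (D i y) (D₀ y)) l (𝓝 (D₀ y)))
    (hint : Tendsto (fun i => ∫ y, D i y ∂μ) l (𝓝 (∫ y, D₀ y ∂μ))) :
    Tendsto (fun i => ∫ y, (D i y - min (D i y) (D₀ y)) ∂μ) l (𝓝 0) := by
  have hmi i : Integrable (fun y => min (D i y) (D₀ y)) μ := (hD i).inf hD₀
  have hm : Tendsto (fun i => ∫ y, min (D i y) (D₀ y) ∂μ) l (𝓝 (∫ y, D₀ y ∂μ)) := by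
    refine tendsto_integral_filter_of_dominated_convergence D₀
      (.of_forall fun i => (hmi i).1) (.of_forall fun i => ?_) hD₀ hmin
    filter_upwards [hD_nonneg i, hD₀_nonneg] with y hy hy₀
    rw [Real.norm_of_nonneg (le_min hy hy₀)]
    exact min_le_right _ _
  simpa only [integral_sub (hD _) (hmi _), sub_self] using hint.sub hm

variable [NormedAddCommGroup E] {a : ι → 𝓨 → E} {a₀ : 𝓨 → E}

lemma tendsto_integral_min_norm_sub (ha : ∀ i, AEStronglyMeasurable (a i) μ)
    (ha₀ : AEStronglyMeasurable a₀ μ) (hD₀ : Integrable D₀ μ) (hD₀_nonneg : 0 ≤ᵐ[μ] D₀)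
    (hlim : ∀ᵐ y ∂μ, Tendsto (fun i => a i y) l (𝓝 (a₀ y))) :
    Tendsto (fun i => ∫ y, min ‖a i y - a₀ y‖ (D₀ y) ∂μ) l (𝓝 0) := by
  rw [← integral_zero 𝓨 ℝ (μ := μ)]
  refine tendsto_integral_filter_of_dominated_convergence D₀
    (.of_forall fun i => ((ha i).sub ha₀).norm.inf hD₀.1) (.of_forall fun i => ?_) hD₀ ?_
  · filter_upwards [hD₀_nonneg] with y hy₀
    rw [Real.norm_of_nonneg (le_min (norm_nonneg _) hy₀)]
    exact min_le_right _ _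
  · filter_upwards [hlim, hD₀_nonneg] with y hy hy₀
    simpa [min_eq_left (show (0 : ℝ) ≤ D₀ y from hy₀)] using
      (tendsto_iff_norm_sub_tendsto_zero.1 hy).min (tendsto_const_nhds (x := D₀ y))

/-- Pratt's form of dominated convergence, in which the bounds `D i` vary and only their lower limit
and the limit of their integrals are controlled. With `m i = min (D i) D₀`, it follows from
`‖a i - a₀‖ ≤ (D i - m i) + min ‖a i - a₀‖ (2 D₀)`, both terms having integrals tending to zero. -/
theorem tendsto_integral_of_tendsto_integral_bound [NormedSpace ℝ E]
    (ha : ∀ i, AEStronglyMeasurable (a i) μ) (hD : ∀ i, Integrable (D i) μ)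
    (hD₀ : Integrable D₀ μ) (haD : ∀ i, ∀ᵐ y ∂μ, ‖a i y‖ ≤ D i y)
    (haD₀ : ∀ᵐ y ∂μ, ‖a₀ y‖ ≤ D₀ y)
    (hlim : ∀ᵐ y ∂μ, Tendsto (fun i => a i y) l (𝓝 (a₀ y)))
    (hmin : ∀ᵐ y ∂μ, Tendsto (fun i => min (D i y) (D₀ y)) l (𝓝 (D₀ y)))
    (hint : Tendsto (fun i => ∫ y, D i y ∂μ) l (𝓝 (∫ y, D₀ y ∂μ))) :
    Tendsto (fun i => ∫ y, a i y ∂μ) l (𝓝 (∫ y, a₀ y ∂μ)) := by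
  rcases l.eq_or_neBot with rfl | _
  · exact tendsto_bot
  have ha₀ : AEStronglyMeasurable a₀ μ := aestronglyMeasurable_of_tendsto_ae l ha hlim
  have hai i : Integrable (a i) μ := (hD i).mono' (ha i) (haD i)
  have ha₀i : Integrable a₀ μ := hD₀.mono' ha₀ haD₀
  have hexcess := tendsto_integral_sub_min hD hD₀
    (fun i => (haD i).mono fun y hy => (norm_nonneg _).trans hy)
    (haD₀.mono fun y hy => (norm_nonneg _).trans hy) hmin hint
  have htrunc := tendsto_integral_min_norm_sub ha ha₀ (hD₀.const_mul 2)
    (haD₀.mono fun y hy => mul_nonneg zero_le_two ((norm_nonneg _).trans hy)) hlim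
  refine tendsto_iff_norm_sub_tendsto_zero.2 <| squeeze_zero (fun _ => norm_nonneg _) (fun i => ?_)
    (by simpa using hexcess.add htrunc)
  have hei : Integrable (fun y => D i y - min (D i y) (D₀ y)) μ := (hD i).sub ((hD i).inf hD₀)
  have hci : Integrable (fun y => min ‖a i y - a₀ y‖ (2 * D₀ y)) μ :=
    ((hai i).sub ha₀i).norm.inf (hD₀.const_mul 2)
  rw [← integral_sub (hai i) ha₀i, ← integral_add hei hci]
  refine norm_integral_le_of_norm_le (hei.add hci) ?_
  filter_upwards [haD i, haD₀] with y hy hy₀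
  have htri := norm_sub_le (a i y) (a₀ y)
  grind

end DominatedConvergence

section DensityPath

variable {𝓨 : Type*} {m𝓨 : MeasurableSpace 𝓨} {μ : Measure 𝓨}

lemma measurable_deriv_of_differentiableAt {E : Type*} [NormedAddCommGroup E] [NormedSpace ℝ E]
    [MeasurableSpace E] [BorelSpace E] [SecondCountableTopology E] {q : ℝ → 𝓨 → E}
    (hq : ∀ s, Measurable (q s)) {s : ℝ} (hd : ∀ y, DifferentiableAt ℝ (fun t => q t y) s) :
    Measurable fun y => deriv (fun t => q t y) s := by
  have hu : Tendsto (fun n : ℕ => 1 / ((n : ℝ) + 1)) atTop (𝓝[≠] 0) :=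
    tendsto_nhdsWithin_iff.2 ⟨tendsto_one_div_add_atTop_nhds_zero_nat,
      .of_forall fun n => Nat.one_div_pos_of_nat.ne'⟩
  refine measurable_of_tendsto_metrizable
    (f := fun (n : ℕ) y => (1 / ((n : ℝ) + 1))⁻¹ • (q (s + 1 / (n + 1)) y - q s y))
    (fun n => ((hq _).sub (hq _)).const_smul _) ?_
  exact tendsto_pi_nhds.2 fun y => (hd y).hasDerivAt.tendsto_slope_zero.comp hu

lemma abs_le_sq_div_add_half {x a : ℝ} (ha : 0 ≤ a) (hx : a = 0 → x = 0) :
    |x| ≤ (x ^ 2 / a + a) / 2 := by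
  rcases ha.eq_or_lt with rfl | ha
  · simp [hx rfl]
  · have hsq : x ^ 2 / a + a - 2 * |x| = (|x| - a) ^ 2 / a := by
      rw [← sq_abs x]
      field_simp
      ring
    linarith [show 0 ≤ (|x| - a) ^ 2 / a by positivity]

/-- `q : ℝ → 𝓨 → ℝ` is a one-parameter family of probability densities with respect to `μ`, defined
and continuously differentiable on the whole line, whose Fisher information `∫ q'² / q` is finite
and continuous. Where `q` vanishes so does `q'`, and the quotient is `0`. -/
structure IsRegularDensityPath (μ : Measure 𝓨) (q : ℝ → 𝓨 → ℝ) : Prop where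
  measurable : ∀ s, Measurable (q s)
  nonneg : ∀ s y, 0 ≤ q s y
  integrable : ∀ s, Integrable (q s) μ
  integral_eq_one : ∀ s, ∫ y, q s y ∂μ = 1
  contDiff : ∀ y, ContDiff ℝ 1 fun s => q s y
  integrable_info : ∀ s, Integrable (fun y => deriv (fun t => q t y) s ^ 2 / q s y) μ
  continuous_info : Continuous fun s => ∫ y, deriv (fun t => q t y) s ^ 2 / q s y ∂μ

/-- The bound `(q'² / q + q) / 2` for `|q'|` given by the inequality of arithmetic and geometric
means; its integral against `μ` is a function of the Fisher information. -/
noncomputable def derivBound (q : ℝ → 𝓨 → ℝ) (s : ℝ) (y : 𝓨) : ℝ :=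
  (deriv (fun t => q t y) s ^ 2 / q s y + q s y) / 2

namespace IsRegularDensityPath

variable {q : ℝ → 𝓨 → ℝ}

lemma hasDerivAt (hq : IsRegularDensityPath μ q) (s : ℝ) (y : 𝓨) :
    HasDerivAt (fun t => q t y) (deriv (fun t => q t y) s) s :=
  ((hq.contDiff y).differentiable one_ne_zero s).hasDerivAt

lemma continuous_deriv (hq : IsRegularDensityPath μ q) (y : 𝓨) :
    Continuous fun s => deriv (fun t => q t y) s :=
  (hq.contDiff y).continuous_deriv le_rfl

lemma measurable_deriv (hq : IsRegularDensityPath μ q) (s : ℝ) :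
    Measurable fun y => deriv (fun t => q t y) s :=
  measurable_deriv_of_differentiableAt hq.measurable fun y => (hq.hasDerivAt s y).differentiableAt

lemma deriv_eq_zero_of_eq_zero (hq : IsRegularDensityPath μ q) {s : ℝ} {y : 𝓨} (h : q s y = 0) :
    deriv (fun t => q t y) s = 0 :=
  IsLocalMin.deriv_eq_zero (.of_forall fun t => by simpa only [h] using hq.nonneg t y)

lemma norm_deriv_le_derivBound (hq : IsRegularDensityPath μ q) (s : ℝ) (y : 𝓨) :
    ‖deriv (fun t => q t y) s‖ ≤ derivBound q s y :=
  abs_le_sq_div_add_half (hq.nonneg s y) hq.deriv_eq_zero_of_eq_zero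

lemma derivBound_nonneg (hq : IsRegularDensityPath μ q) (s : ℝ) (y : 𝓨) : 0 ≤ derivBound q s y :=
  (norm_nonneg _).trans (hq.norm_deriv_le_derivBound s y)

lemma integrable_derivBound (hq : IsRegularDensityPath μ q) (s : ℝ) :
    Integrable (derivBound q s) μ :=
  ((hq.integrable_info s).add (hq.integrable s)).div_const 2

lemma continuous_integral_derivBound (hq : IsRegularDensityPath μ q) :
    Continuous fun s => ∫ y, derivBound q s y ∂μ := by
  have hD s : ∫ y, derivBound q s y ∂μ =
      (∫ y, deriv (fun t => q t y) s ^ 2 / q s y ∂μ + 1) / 2 := by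
    simp only [derivBound]
    rw [integral_div, integral_add (hq.integrable_info s) (hq.integrable s), hq.integral_eq_one]
  simpa only [hD] using (hq.continuous_info.add_const 1).div_const 2

/-- `derivBound q` may jump where `q` vanishes, but only upwards. -/
lemma tendsto_min_derivBound (hq : IsRegularDensityPath μ q) (s₀ : ℝ) (y : 𝓨) :
    Tendsto (fun s => min (derivBound q s y) (derivBound q s₀ y)) (𝓝 s₀)
      (𝓝 (derivBound q s₀ y)) := by
  rcases eq_or_ne (q s₀ y) 0 with h | h
  · have h₀ : derivBound q s₀ y = 0 := by simp [derivBound, h]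
    simpa only [h₀, min_eq_right (hq.derivBound_nonneg _ y)] using tendsto_const_nhds
  · have hc := (hq.hasDerivAt s₀ y).continuousAt
    have : ContinuousAt (fun s => derivBound q s y) s₀ :=
      ((((hq.continuous_deriv y).continuousAt.pow 2).div hc h).add hc).div_const 2
    simpa using Tendsto.min this (tendsto_const_nhds (x := derivBound q s₀ y))

lemma continuous_integral_deriv (hq : IsRegularDensityPath μ q) :
    Continuous fun s => ∫ y, deriv (fun t => q t y) s ∂μ :=
  continuous_iff_continuousAt.2 fun s₀ => tendsto_integral_of_tendsto_integral_bound
    (fun s => (hq.measurable_deriv s).aestronglyMeasurable) hq.integrable_derivBound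
    (hq.integrable_derivBound s₀) (fun s => ae_of_all _ (hq.norm_deriv_le_derivBound s))
    (ae_of_all _ (hq.norm_deriv_le_derivBound s₀))
    (ae_of_all _ fun y => (hq.continuous_deriv y).tendsto s₀)
    (ae_of_all _ (hq.tendsto_min_derivBound s₀)) (hq.continuous_integral_derivBound.tendsto s₀)

variable [SFinite μ]

lemma integrable_uncurry_deriv (hq : IsRegularDensityPath μ q) (s t : ℝ) :
    Integrable (Function.uncurry fun r y => deriv (fun t => q t y) r)
      ((volume.restrict (Set.uIoc s t)).prod μ) := by
  have hm : Measurable (Function.uncurry fun r y => deriv (fun t => q t y) r) :=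
    measurable_uncurry_of_continuous_of_measurable hq.continuous_deriv hq.measurable_deriv
  refine (integrable_prod_iff hm.aestronglyMeasurable).2 ⟨ae_of_all _ fun r =>
    (hq.integrable_derivBound r).mono' (hq.measurable_deriv r).aestronglyMeasurable
      (ae_of_all _ (hq.norm_deriv_le_derivBound r)), ?_⟩
  refine Integrable.mono' (g := fun r => ∫ y, derivBound q r y ∂μ)
    ((hq.continuous_integral_derivBound.integrableOn_uIcc (a := s) (b := t)).mono_set
      Set.uIoc_subset_uIcc)
    hm.aestronglyMeasurable.norm.integral_prod_right' (ae_of_all _ fun r => ?_)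
  rw [Real.norm_of_nonneg (integral_nonneg fun _ => norm_nonneg _)]
  exact integral_mono_of_nonneg (ae_of_all _ fun _ => norm_nonneg _) (hq.integrable_derivBound r)
    (ae_of_all _ (hq.norm_deriv_le_derivBound r))

lemma intervalIntegral_integral_deriv (hq : IsRegularDensityPath μ q) (s t : ℝ) :
    ∫ r in s..t, ∫ y, deriv (fun t => q t y) r ∂μ = 0 := by
  have hftc y : ∫ r in s..t, deriv (fun t => q t y) r = q t y - q s y :=
    intervalIntegral.integral_eq_sub_of_hasDerivAt (fun r _ => hq.hasDerivAt r y)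
      ((hq.continuous_deriv y).intervalIntegrable _ _)
  calc ∫ r in s..t, ∫ y, deriv (fun t => q t y) r ∂μ
    _ = ∫ y, (∫ r in s..t, deriv (fun t => q t y) r) ∂μ :=
      intervalIntegral_integral_swap (hq.integrable_uncurry_deriv s t)
    _ = ∫ y, (q t y - q s y) ∂μ := by simp only [hftc]
    _ = 0 := by
      rw [integral_sub (hq.integrable t) (hq.integrable s), hq.integral_eq_one,
        hq.integral_eq_one, sub_self]

theorem integral_deriv_eq_zero (hq : IsRegularDensityPath μ q) (s : ℝ) :
    ∫ y, deriv (fun t => q t y) s ∂μ = 0 := by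
  have h := hq.continuous_integral_deriv.deriv_integral _ s s
  simpa only [hq.intervalIntegral_integral_deriv, deriv_const'] using h.symm

end IsRegularDensityPath

end DensityPath

section DensityFamily

variable {𝓨 : Type*} {m𝓨 : MeasurableSpace 𝓨} {μ : Measure 𝓨}

/-- The measure with density `p` with respect to `μ`. The negative part of `p` is discarded. -/
noncomputable def densityLaw (μ : Measure 𝓨) (p : 𝓨 → ℝ) : Measure 𝓨 :=
  μ.withDensity fun y => ENNReal.ofReal (p y)

section DensityLaw

variable {p : 𝓨 → ℝ} (hp : Measurable p) (hp0 : ∀ y, 0 ≤ p y)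

include hp hp0

lemma integral_densityLaw {E : Type*} [NormedAddCommGroup E] [NormedSpace ℝ E] (F : 𝓨 → E) :
    ∫ y, F y ∂(densityLaw μ p) = ∫ y, p y • F y ∂μ := by
  rw [densityLaw, integral_withDensity_eq_integral_toReal_smul hp.ennreal_ofReal
    (ae_of_all _ fun _ => ENNReal.ofReal_lt_top)]
  simp only [ENNReal.toReal_ofReal (hp0 _)]

lemma integrable_densityLaw_iff {E : Type*} [NormedAddCommGroup E] [NormedSpace ℝ E] {F : 𝓨 → E} :
    Integrable F (densityLaw μ p) ↔ Integrable (fun y => p y • F y) μ := by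
  rw [densityLaw, integrable_withDensity_iff_integrable_smul' hp.ennreal_ofReal
    (ae_of_all _ fun _ => ENNReal.ofReal_lt_top)]
  simp only [ENNReal.toReal_ofReal (hp0 _)]

variable [IsProbabilityMeasure (densityLaw μ p)]

lemma integrable_of_isProbabilityMeasure_densityLaw : Integrable p μ := by
  simpa using (integrable_densityLaw_iff hp hp0).1 (integrable_const (1 : ℝ))

lemma integral_eq_one_of_isProbabilityMeasure_densityLaw : ∫ y, p y ∂μ = 1 := by
  simpa using (integral_densityLaw (μ := μ) hp hp0 fun _ => (1 : ℝ)).symm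

end DensityLaw

variable {E : Type*} [NormedAddCommGroup E] [NormedSpace ℝ E] {g : E → 𝓨 → ℝ} {U : Set E}

/-- A family of probability densities with respect to `μ`, indexed by an open set `U` of parameters
on which it is continuously differentiable. The values of `g` outside `U` are irrelevant. -/
structure IsSmoothDensityFamily (μ : Measure 𝓨) (g : E → 𝓨 → ℝ) (U : Set E) : Prop where
  isOpen : IsOpen U
  measurable : ∀ x ∈ U, Measurable (g x)
  nonneg : ∀ x ∈ U, ∀ y, 0 ≤ g x y
  isProbabilityMeasure : ∀ x ∈ U, IsProbabilityMeasure (densityLaw μ (g x))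
  contDiffOn : ∀ᵐ y ∂μ, ContDiffOn ℝ 1 (fun x => g x y) U

/-- The sine keeps the path inside `U` for all times. -/
lemma exists_forall_add_mul_sin_smul_mem (hU : IsOpen U) {x : E} (hx : x ∈ U) (v : E) :
    ∃ δ > 0, ∀ s : ℝ, x + (δ * Real.sin s) • v ∈ U := by
  have hline : ∀ᶠ t : ℝ in 𝓝 0, x + t • v ∈ U := by
    have hc : Continuous fun t : ℝ => x + t • v := by fun_prop
    exact hc.tendsto' 0 x (by simp) (hU.mem_nhds hx)
  obtain ⟨r, hr, hball⟩ := Metric.eventually_nhds_iff.1 hline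
  refine ⟨r / 2, half_pos hr, fun s => hball ?_⟩
  rw [Real.dist_eq, sub_zero, abs_mul, abs_of_pos (half_pos hr)]
  nlinarith [Real.abs_sin_le_one s]

lemma contDiff_indicator_path {A : Set 𝓨} {p : ℝ → E} (hU : IsOpen U) (hpU : ∀ s, p s ∈ U)
    (hp : ContDiff ℝ 1 p) (hA : ∀ y ∈ A, ContDiffOn ℝ 1 (fun x => g x y) U) (y : 𝓨) :
    ContDiff ℝ 1 fun s => A.indicator (g (p s)) y := by
  by_cases hy : y ∈ A
  · simp only [Set.indicator_of_mem hy]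
    exact contDiff_iff_contDiffAt.2 fun s =>
      ((hA y hy).contDiffAt (hU.mem_nhds (hpU s))).comp s hp.contDiffAt
  · simpa only [Set.indicator_of_notMem hy] using contDiff_const

lemma deriv_comp_path {p : ℝ → E} {y : 𝓨} {s c : ℝ} {v : E}
    (hg : DifferentiableAt ℝ (fun x => g x y) (p s)) (hp : HasDerivAt p (c • v) s) :
    deriv (fun t => g (p t) y) s = c * fderiv ℝ (fun x => g x y) (p s) v := by
  have h : HasDerivAt (fun t => g (p t) y) (fderiv ℝ (fun x => g x y) (p s) (c • v)) s :=
    hg.hasFDerivAt.comp_hasDerivAt s hp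
  simpa using h.deriv

namespace IsSmoothDensityFamily

lemma differentiableAt (hg : IsSmoothDensityFamily μ g U) {x : E} (hx : x ∈ U) {y : 𝓨}
    (hy : ContDiffOn ℝ 1 (fun x => g x y) U) : DifferentiableAt ℝ (fun x => g x y) x :=
  (hy.contDiffAt (hg.isOpen.mem_nhds hx)).differentiableAt one_ne_zero

lemma isRegularDensityPath (hg : IsSmoothDensityFamily μ g U) {v : E}
    (hint : ∀ x ∈ U, Integrable (fun y => fderiv ℝ (fun x => g x y) x v ^ 2 / g x y) μ)
    (hcont : ContinuousOn (fun x => ∫ y, fderiv ℝ (fun x => g x y) x v ^ 2 / g x y ∂μ) U)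
    {A : Set 𝓨} (hA : MeasurableSet A) (hAe : ∀ᵐ y ∂μ, y ∈ A)
    (hAg : ∀ y ∈ A, ContDiffOn ℝ 1 (fun x => g x y) U) {p : ℝ → E} {c : ℝ → ℝ}
    (hp : ContDiff ℝ 1 p) (hpU : ∀ s, p s ∈ U) (hc : Continuous c)
    (hpc : ∀ s, HasDerivAt p (c s • v) s) :
    IsRegularDensityPath μ fun s => A.indicator (g (p s)) := by
  have hq s : A.indicator (g (p s)) =ᵐ[μ] g (p s) :=
    hAe.mono fun y hy => Set.indicator_of_mem hy _
  have hinfo s : (fun y => deriv (fun t => A.indicator (g (p t)) y) s ^ 2 /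
      A.indicator (g (p s)) y) =ᵐ[μ]
      fun y => c s ^ 2 * (fderiv ℝ (fun x => g x y) (p s) v ^ 2 / g (p s) y) := by
    filter_upwards [hAe] with y hy
    simp only [Set.indicator_of_mem hy]
    rw [deriv_comp_path (hg.differentiableAt (hpU s) (hAg y hy)) (hpc s), mul_pow, mul_div_assoc]
  refine ⟨fun s => (hg.measurable _ (hpU s)).indicator hA,
    fun s => Set.indicator_nonneg fun y _ => hg.nonneg _ (hpU s) y, fun s => ?_, fun s => ?_,
    contDiff_indicator_path hg.isOpen hpU hp hAg,
    fun s => ((hint _ (hpU s)).const_mul _).congr (hinfo s).symm, ?_⟩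
  · have := hg.isProbabilityMeasure _ (hpU s)
    exact (integrable_of_isProbabilityMeasure_densityLaw (hg.measurable _ (hpU s))
      (hg.nonneg _ (hpU s))).congr (hq s).symm
  · have := hg.isProbabilityMeasure _ (hpU s)
    rw [integral_congr_ae (hq s), integral_eq_one_of_isProbabilityMeasure_densityLaw
      (hg.measurable _ (hpU s)) (hg.nonneg _ (hpU s))]
  · simp only [integral_congr_ae (hinfo _), integral_const_mul]
    exact (hc.pow 2).mul (hcont.comp_continuous hp.continuous hpU)

lemma fderiv_eq_zero_of_eq_zero (hg : IsSmoothDensityFamily μ g U) {x : E} (hx : x ∈ U) {y : 𝓨}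
    (h : g x y = 0) : fderiv ℝ (fun x => g x y) x = 0 := by
  refine IsLocalMin.fderiv_eq_zero ?_
  filter_upwards [hg.isOpen.mem_nhds hx] with x' hx'
  simpa only [h] using hg.nonneg x' hx' y

theorem integral_fderiv_eq_zero [SFinite μ] (hg : IsSmoothDensityFamily μ g U) {v : E}
    (hint : ∀ x ∈ U, Integrable (fun y => fderiv ℝ (fun x => g x y) x v ^ 2 / g x y) μ)
    (hcont : ContinuousOn (fun x => ∫ y, fderiv ℝ (fun x => g x y) x v ^ 2 / g x y ∂μ) U)
    {x : E} (hx : x ∈ U) : ∫ y, fderiv ℝ (fun x => g x y) x v ∂μ = 0 := by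
  obtain ⟨A, hAe, hA, hAg⟩ := hg.contDiffOn.exists_measurable_mem
  obtain ⟨δ, hδ, hpU⟩ := exists_forall_add_mul_sin_smul_mem hg.isOpen hx v
  have hp s : HasDerivAt (fun s => x + (δ * Real.sin s) • v) ((δ * Real.cos s) • v) s :=
    (((Real.hasDerivAt_sin s).const_mul δ).smul_const v).const_add x
  have hpath := hg.isRegularDensityPath hint hcont hA hAe hAg (by fun_prop) hpU (by fun_prop) hp
  have hderiv : (fun y => deriv (fun s => A.indicator (g (x + (δ * Real.sin s) • v)) y) 0) =ᵐ[μ]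
      fun y => δ * fderiv ℝ (fun x => g x y) x v := by
    filter_upwards [hAe] with y hy
    simp only [Set.indicator_of_mem hy]
    rw [deriv_comp_path (hg.differentiableAt (hpU 0) (hAg y hy)) (hp 0)]
    simp
  have hzero := hpath.integral_deriv_eq_zero 0
  rw [integral_congr_ae hderiv, integral_const_mul] at hzero
  exact (mul_eq_zero.1 hzero).resolve_left hδ.ne'

end IsSmoothDensityFamily

end DensityFamily

section SecondMoment

variable {𝓨 ι κ : Type*} {m𝓨 : MeasurableSpace 𝓨} {G : Measure 𝓨}

/-- The matrix of second moments of a random vector `ψ` under `G`. For the score of a family of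
densities this is the Fisher information matrix. -/
noncomputable def secondMoment (G : Measure 𝓨) (ψ : 𝓨 → EuclideanSpace ℝ ι) : Matrix ι ι ℝ :=
  Matrix.of fun a b => ∫ y, ψ y a * ψ y b ∂G

variable [Fintype ι] {ψ : 𝓨 → EuclideanSpace ℝ ι}

lemma memLp_apply (hψ : MemLp ψ 2 G) (a : ι) : MemLp (fun y => ψ y a) 2 G :=
  (EuclideanSpace.proj a : EuclideanSpace ℝ ι →L[ℝ] ℝ).comp_memLp' hψ

lemma integral_inner_mul_inner (hψ : MemLp ψ 2 G) (u v : EuclideanSpace ℝ ι) :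
    ∫ y, ⟪u, ψ y⟫ * ⟪v, ψ y⟫ ∂G = u.ofLp ⬝ᵥ secondMoment G ψ *ᵥ v.ofLp := by
  have hint a b : Integrable (fun y => u a * (ψ y a * ψ y b * v b)) G :=
    (((memLp_apply hψ a).integrable_mul (memLp_apply hψ b)).mul_const _).const_mul _
  calc ∫ y, ⟪u, ψ y⟫ * ⟪v, ψ y⟫ ∂G
    _ = ∫ y, ∑ a, ∑ b, u a * (ψ y a * ψ y b * v b) ∂G := by
      refine integral_congr_ae (ae_of_all _ fun y => ?_)
      simp only [PiLp.inner_apply, RCLike.inner_apply, conj_trivial, Finset.sum_mul_sum]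
      exact Finset.sum_congr rfl fun a _ => Finset.sum_congr rfl fun b _ => by ring
    _ = u.ofLp ⬝ᵥ secondMoment G ψ *ᵥ v.ofLp := by
      simp only [integral_finsetSum _ fun a _ => integrable_finsetSum _ fun b _ => hint a b,
        integral_finsetSum _ fun b _ => hint _ b, integral_const_mul, integral_mul_const,
        dotProduct, Matrix.mulVec, secondMoment, Matrix.of_apply, Finset.mul_sum]

lemma posSemidef_secondMoment (hψ : MemLp ψ 2 G) : (secondMoment G ψ).PosSemidef := by
  refine .of_dotProduct_mulVec_nonneg ?_ fun v => ?_
  · ext a b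
    simp [secondMoment, mul_comm]
  · rw [star_trivial, ← integral_inner_mul_inner hψ (WithLp.toLp 2 v) (WithLp.toLp 2 v)]
    exact integral_nonneg fun y => mul_self_nonneg _

lemma integral_apply (hψ : Integrable ψ G) (a : ι) : (∫ y, ψ y ∂G) a = ∫ y, ψ y a ∂G :=
  ((EuclideanSpace.proj a : EuclideanSpace ℝ ι →L[ℝ] ℝ).integral_comp_comm hψ).symm

section LinearImage

variable {B : Matrix κ ι ℝ}

lemma secondMoment_mulVec (hψ : MemLp ψ 2 G) :
    secondMoment G (fun y => WithLp.toLp 2 (B *ᵥ (ψ y).ofLp)) = B * secondMoment G ψ * Bᵀ := by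
  ext a b
  calc secondMoment G (fun y => WithLp.toLp 2 (B *ᵥ (ψ y).ofLp)) a b
    _ = ∫ y, ⟪WithLp.toLp 2 (B a), ψ y⟫ * ⟪WithLp.toLp 2 (B b), ψ y⟫ ∂G := by
      simp only [secondMoment, Matrix.of_apply, Matrix.mulVec, dotProduct, PiLp.inner_apply,
        RCLike.inner_apply, conj_trivial, mul_comm]
    _ = B a ⬝ᵥ secondMoment G ψ *ᵥ B b := integral_inner_mul_inner hψ _ _
    _ = (B * secondMoment G ψ * Bᵀ) a b := by
      rw [Matrix.dotProduct_mulVec]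
      rfl

variable [Fintype κ]

lemma memLp_mulVec (hψ : MemLp ψ 2 G) : MemLp (fun y => WithLp.toLp 2 (B *ᵥ (ψ y).ofLp)) 2 G := by
  classical exact (Matrix.toLpLin 2 2 B).toContinuousLinearMap.comp_memLp' hψ

lemma integral_mulVec (hψ : Integrable ψ G) :
    ∫ y, WithLp.toLp 2 (B *ᵥ (ψ y).ofLp) ∂G = WithLp.toLp 2 (B *ᵥ (∫ y, ψ y ∂G).ofLp) := by
  classical exact (Matrix.toLpLin 2 2 B).toContinuousLinearMap.integral_comp_comm hψ

end LinearImage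

section Residual

variable [Fintype κ] [DecidableEq κ] {φ : 𝓨 → EuclideanSpace ℝ (ι ⊕ κ)}

/-- The residual `φ₁ - S₁₂ S₂₂⁻¹ φ₂` of the first block of a random vector `φ = (φ₁, φ₂)` after
linear regression on the second block. For the score of a family of densities this is the
efficient score for the first block of parameters. -/
noncomputable def regressionResidual (G : Measure 𝓨) (φ : 𝓨 → EuclideanSpace ℝ (ι ⊕ κ)) (y : 𝓨) :
    EuclideanSpace ℝ ι :=
  WithLp.toLp 2 (fun a => φ y (.inl a)) - WithLp.toLp 2
    (((secondMoment G φ).toBlocks₁₂ * (secondMoment G φ).toBlocks₂₂⁻¹) *ᵥ fun b => φ y (.inr b))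

lemma regressionResidual_eq_mulVec [DecidableEq ι] (G : Measure 𝓨)
    (φ : 𝓨 → EuclideanSpace ℝ (ι ⊕ κ)) :
    regressionResidual G φ = fun y => WithLp.toLp 2 (Matrix.fromCols 1
      (-((secondMoment G φ).toBlocks₁₂ * (secondMoment G φ).toBlocks₂₂⁻¹)) *ᵥ (φ y).ofLp) := by
  ext y a
  simp [regressionResidual, Matrix.fromCols_mulVec, Matrix.neg_mulVec, sub_eq_add_neg]
  rfl

lemma posDef_secondMoment_regressionResidual [DecidableEq ι] (hφ : MemLp φ 2 G)
    (hdet : IsUnit (secondMoment G φ).det) :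
    (secondMoment G (regressionResidual G φ)).PosDef := by
  have hpos : (secondMoment G φ).PosDef := (posSemidef_secondMoment hφ).posDef_iff_isUnit.2
    ((Matrix.isUnit_iff_isUnit_det _).2 hdet)
  rw [regressionResidual_eq_mulVec, secondMoment_mulVec hφ,
    ← Matrix.conjTranspose_eq_transpose_of_trivial]
  refine hpos.mul_mul_conjTranspose_same fun u v huv => ?_
  simp only [Matrix.vecMul_fromCols, Matrix.vecMul_one] at huv
  exact (Sum.elim_eq_iff.1 huv).1

lemma memLp_regressionResidual (hφ : MemLp φ 2 G) : MemLp (regressionResidual G φ) 2 G := by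
  classical
  rw [regressionResidual_eq_mulVec]
  exact memLp_mulVec hφ

lemma integral_regressionResidual_eq_zero (hφ : Integrable φ G) (hφ₀ : ∫ y, φ y ∂G = 0) :
    ∫ y, regressionResidual G φ y ∂G = 0 := by
  classical
  rw [regressionResidual_eq_mulVec, integral_mulVec hφ, hφ₀]
  simp

end Residual

end SecondMoment

section Score

variable {𝓨 ι κ F : Type*} {m𝓨 : MeasurableSpace 𝓨} {μ : Measure 𝓨}

/-- The score `∇p / p` of a family of densities, set to `0` where the density vanishes. -/
noncomputable def score [NormedAddCommGroup F] [InnerProductSpace ℝ F] [CompleteSpace F]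
    (p : F → 𝓨 → ℝ) (x : F) (y : 𝓨) : F :=
  {y | 0 < p x y}.indicator (fun y => (p x y)⁻¹ • gradient (fun x' => p x' y) x) y

lemma mul_inner_score [NormedAddCommGroup F] [InnerProductSpace ℝ F] [CompleteSpace F]
    {p : F → 𝓨 → ℝ} {x : F} {y : 𝓨} (h : 0 < p x y) (v : F) :
    p x y * ⟪v, score p x y⟫ = fderiv ℝ (fun x => p x y) x v := by
  rw [score, Set.indicator_of_mem (s := {y | 0 < p x y}) h, real_inner_smul_right,
    mul_inv_cancel_left₀ h.ne', real_inner_comm, inner_gradient_left]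

variable [Fintype ι] [Fintype κ] {g : EuclideanSpace ℝ ι → EuclideanSpace ℝ κ → 𝓨 → ℝ}
  {U : Set (EuclideanSpace ℝ ι × EuclideanSpace ℝ κ)} {θ : EuclideanSpace ℝ ι}
  {η : EuclideanSpace ℝ κ}

/-- The score of a family of densities with two blocks of parameters, as one vector. -/
noncomputable def jointScore (g : EuclideanSpace ℝ ι → EuclideanSpace ℝ κ → 𝓨 → ℝ)
    (θ : EuclideanSpace ℝ ι) (η : EuclideanSpace ℝ κ) (y : 𝓨) : EuclideanSpace ℝ (ι ⊕ κ) :=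
  WithLp.toLp 2 (Sum.elim (score (fun θ' => g θ' η) θ y).ofLp (score (g θ) η y).ofLp)

/-- A smooth family of densities with two blocks of parameters whose score is square integrable and
whose Fisher information is continuous. -/
structure IsRegularDensityFamily (μ : Measure 𝓨)
    (g : EuclideanSpace ℝ ι → EuclideanSpace ℝ κ → 𝓨 → ℝ)
    (U : Set (EuclideanSpace ℝ ι × EuclideanSpace ℝ κ)) : Prop extends
    IsSmoothDensityFamily μ (fun x => g x.1 x.2) U where
  memLp_score : ∀ x ∈ U, MemLp (jointScore g x.1 x.2) 2 (densityLaw μ (g x.1 x.2))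
  continuousOn_info : ContinuousOn
    (fun x => secondMoment (densityLaw μ (g x.1 x.2)) (jointScore g x.1 x.2)) U

open scoped Classical in
/-- The coordinate directions of the product of the two parameter spaces. -/
noncomputable def coordDir :
    ι ⊕ κ → EuclideanSpace ℝ ι × EuclideanSpace ℝ κ :=
  Sum.elim (fun a => (EuclideanSpace.single a 1, 0)) fun b => (0, EuclideanSpace.single b 1)

lemma mul_jointScore_of_pos {y : 𝓨} (hpos : 0 < g θ η y)
    (hg : DifferentiableAt ℝ (fun x : _ × _ => g x.1 x.2 y) (θ, η)) (c : ι ⊕ κ) :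
    g θ η y * jointScore g θ η y c =
      fderiv ℝ (fun x : _ × _ => g x.1 x.2 y) (θ, η) (coordDir c) := by
  classical
  rcases c with a | b
  · have hθ : HasFDerivAt (fun θ' => g θ' η y) _ θ :=
      hg.hasFDerivAt.comp (f := fun θ' => (θ', η)) θ (hasFDerivAt_prodMk_left θ η)
    have h := mul_inner_score (p := fun θ' => g θ' η) hpos (EuclideanSpace.single a 1)
    simpa [jointScore, coordDir, hθ.fderiv, EuclideanSpace.inner_single_left] using h
  · have hη : HasFDerivAt (fun η' => g θ η' y) _ η :=
      hg.hasFDerivAt.comp (f := fun η' => (θ, η')) η (hasFDerivAt_prodMk_right θ η)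
    have h := mul_inner_score (p := g θ) hpos (EuclideanSpace.single b 1)
    simpa [jointScore, coordDir, hη.fderiv, EuclideanSpace.inner_single_left] using h

namespace IsRegularDensityFamily

lemma mul_jointScore (hg : IsRegularDensityFamily μ g U) (hx : (θ, η) ∈ U) (c : ι ⊕ κ) :
    (fun y => g θ η y * jointScore g θ η y c) =ᵐ[μ]
      fun y => fderiv ℝ (fun x : _ × _ => g x.1 x.2 y) (θ, η) (coordDir c) := by
  filter_upwards [hg.contDiffOn] with y hy
  rcases (hg.nonneg _ hx y).eq_or_lt with h | h
  · simp [hg.fderiv_eq_zero_of_eq_zero hx h.symm, show g θ η y = 0 from h.symm]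
  · exact mul_jointScore_of_pos h (hg.differentiableAt hx hy) c

lemma fderiv_sq_div (hg : IsRegularDensityFamily μ g U) (hx : (θ, η) ∈ U) (c : ι ⊕ κ) :
    (fun y => fderiv ℝ (fun x : _ × _ => g x.1 x.2 y) (θ, η) (coordDir c) ^ 2 / g θ η y) =ᵐ[μ]
      fun y => g θ η y * (jointScore g θ η y c * jointScore g θ η y c) := by
  filter_upwards [hg.mul_jointScore hx c] with y hy
  rw [← hy]
  rcases eq_or_ne (g θ η y) 0 with h | h
  · simp [h]
  · field_simp

lemma integrable_fderiv_sq_div (hg : IsRegularDensityFamily μ g U) (hx : (θ, η) ∈ U) (c : ι ⊕ κ) :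
    Integrable (fun y =>
      fderiv ℝ (fun x : _ × _ => g x.1 x.2 y) (θ, η) (coordDir c) ^ 2 / g θ η y) μ := by
  have hc := memLp_apply (hg.memLp_score _ hx) c
  exact ((integrable_densityLaw_iff (hg.measurable _ hx) (hg.nonneg _ hx)).1
    (hc.integrable_mul hc)).congr (hg.fderiv_sq_div hx c).symm

lemma integral_fderiv_sq_div (hg : IsRegularDensityFamily μ g U) (hx : (θ, η) ∈ U) (c : ι ⊕ κ) :
    ∫ y, fderiv ℝ (fun x : _ × _ => g x.1 x.2 y) (θ, η) (coordDir c) ^ 2 / g θ η y ∂μ =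
      secondMoment (densityLaw μ (g θ η)) (jointScore g θ η) c c := by
  rw [integral_congr_ae (hg.fderiv_sq_div hx c)]
  exact (integral_densityLaw (hg.measurable _ hx) (hg.nonneg _ hx) _).symm

theorem integral_jointScore_eq_zero [SFinite μ] (hg : IsRegularDensityFamily μ g U)
    (hx : (θ, η) ∈ U) : ∫ y, jointScore g θ η y ∂(densityLaw μ (g θ η)) = 0 := by
  have := hg.isProbabilityMeasure _ hx
  have hint := (hg.memLp_score _ hx).integrable one_le_two
  ext c
  have hcont : ContinuousOn (fun x => ∫ y,
      fderiv ℝ (fun x : _ × _ => g x.1 x.2 y) x (coordDir c) ^ 2 / g x.1 x.2 y ∂μ) U :=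
    ((continuous_apply_apply c c).comp_continuousOn hg.continuousOn_info).congr
      fun x hx => hg.integral_fderiv_sq_div hx c
  calc (∫ y, jointScore g θ η y ∂(densityLaw μ (g θ η))) c
    _ = ∫ y, jointScore g θ η y c ∂(densityLaw μ (g θ η)) := integral_apply hint c
    _ = ∫ y, g θ η y * jointScore g θ η y c ∂μ :=
      integral_densityLaw (hg.measurable _ hx) (hg.nonneg _ hx) _
    _ = ∫ y, fderiv ℝ (fun x : _ × _ => g x.1 x.2 y) (θ, η) (coordDir c) ∂μ :=
      integral_congr_ae (hg.mul_jointScore hx c)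
    _ = 0 := hg.integral_fderiv_eq_zero (fun x hx => hg.integrable_fderiv_sq_div hx c) hcont hx

end IsRegularDensityFamily

end Score

section Asymptotics

variable {𝓨 Ω E : Type*} {m𝓨 : MeasurableSpace 𝓨} {mΩ : MeasurableSpace Ω} {G : Measure 𝓨}
  {P : Measure Ω} {Y : ℕ → Ω → 𝓨}

/-- The nonnegative statistics `R n`, functions of `n` observations, tend to zero in probability
when the observations are independent with law `G`. -/
def IsNegligible (G : Measure 𝓨) (R : (n : ℕ) → (Fin n → 𝓨) → ℝ) : Prop :=
  ∀ ε : ℝ, 0 < ε → Tendsto (fun n => Measure.pi (fun _ : Fin n => G) {y | ε ≤ R n y}) atTop (𝓝 0)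

/-- The normalized sum `n^{-1/2} ∑ⱼ s n y j` of vectors computed from `n` observations `y`. -/
noncomputable def normalizedSum [AddCommGroup E] [Module ℝ E]
    (s : (n : ℕ) → (Fin n → 𝓨) → Fin n → E) (n : ℕ) (y : Fin n → 𝓨) : E :=
  (1 / √(n : ℝ)) • ∑ j, s n y j

lemma normalizedSum_sub [AddCommGroup E] [Module ℝ E] (s t : (n : ℕ) → (Fin n → 𝓨) → Fin n → E)
    (n : ℕ) (y : Fin n → 𝓨) : normalizedSum (fun n y j => s n y j - t n y j) n y =
      normalizedSum s n y - normalizedSum t n y := by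
  simp only [normalizedSum, Finset.sum_sub_distrib, smul_sub]

lemma hasLaw_sample [IsProbabilityMeasure P] (hY : ∀ i, HasLaw (Y i) G P) (hindep : iIndepFun Y P)
    (n : ℕ) : HasLaw (fun ω (j : Fin n) => Y j ω) (Measure.pi fun _ => G) P :=
  (hindep.precomp Fin.val_injective).hasLaw_pi fun j => hY j

variable [IsProbabilityMeasure P]

lemma IsNegligible.tendstoInMeasure [SeminormedAddCommGroup E]
    {R : (n : ℕ) → (Fin n → 𝓨) → ℝ} (hR : IsNegligible G R) (hY : ∀ i, HasLaw (Y i) G P)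
    (hindep : iIndepFun Y P) {Z : ℕ → Ω → E} {Z₀ : Ω → E}
    (hZ : ∀ n ω, ‖Z n ω - Z₀ ω‖ ≤ R n fun j : Fin n => Y j ω) :
    TendstoInMeasure P Z atTop Z₀ := by
  refine tendstoInMeasure_iff_norm.2 fun ε hε => ?_
  refine tendsto_of_tendsto_of_tendsto_of_le_of_le tendsto_const_nhds (hR ε hε)
    (fun _ => zero_le) fun n => ?_
  calc P {ω | ε ≤ ‖Z n ω - Z₀ ω‖}
    _ ≤ P ((fun ω (j : Fin n) => Y j ω) ⁻¹' {y | ε ≤ R n y}) :=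
      measure_mono fun ω hω => le_trans (show ε ≤ _ from hω) (hZ n ω)
    _ ≤ Measure.pi (fun _ => G) {y | ε ≤ R n y} := by
      rw [← (hasLaw_sample hY hindep n).map_eq]
      exact Measure.le_map_apply (hasLaw_sample hY hindep n).aemeasurable _

variable {ι : Type*} [Fintype ι] [DecidableEq ι] [IsProbabilityMeasure G]

lemma covarianceBilin_map_eq_covarianceBilin_multivariateGaussian {ψ : 𝓨 → EuclideanSpace ℝ ι}
    (hψ : MemLp ψ 2 G) (hψ₀ : ∫ y, ψ y ∂G = 0) :
    covarianceBilin (multivariateGaussian 0 (secondMoment G ψ)) = covarianceBilin (G.map ψ) := by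
  have hlaw : MemLp id 2 (G.map ψ) :=
    (memLp_map_measure_iff aestronglyMeasurable_id hψ.aemeasurable).2 hψ
  have hmean : (G.map ψ)[id] = 0 := by
    rw [integral_map hψ.aemeasurable aestronglyMeasurable_id]
    exact hψ₀
  ext u v
  rw [covarianceBilin_multivariateGaussian (posSemidef_secondMoment hψ),
    covarianceBilin_apply hlaw, hmean, ← integral_inner_mul_inner hψ,
    integral_map hψ.aemeasurable (by fun_prop)]
  simp only [sub_zero]

theorem tendstoInDistribution_normalizedSum_multivariateGaussian {ψ : 𝓨 → EuclideanSpace ℝ ι}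
    (hψ : MemLp ψ 2 G) (hψ₀ : ∫ y, ψ y ∂G = 0) (hY : ∀ i, HasLaw (Y i) G P)
    (hindep : iIndepFun Y P) :
    TendstoInDistribution
      (fun n ω => normalizedSum (fun _ y j => ψ (y j)) n fun j : Fin n => Y j ω) atTop id
      (fun _ => P) (multivariateGaussian 0 (secondMoment G ψ)) := by
  have hX i : HasLaw (fun ω => ψ (Y i ω)) (G.map ψ) P :=
    HasLaw.fun_comp ⟨hψ.aemeasurable, rfl⟩ (hY i)
  have hmean : P[fun ω => ψ (Y 0 ω)] = 0 := ((hY 0).integral_comp hψ.1).trans hψ₀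
  have hX₀ : MemLp (fun ω => ψ (Y 0 ω)) 2 P :=
    MemLp.comp_of_map (by rwa [(hY 0).map_eq]) (hY 0).aemeasurable
  have hclt := tendstoInDistribution_inv_sqrt_smul_sum_sub (X := fun i ω => ψ (Y i ω))
    (ν := multivariateGaussian 0 (secondMoment G ψ)) HasLaw.id integral_id_multivariateGaussian hX₀
    (by rw [(hX 0).map_eq, covarianceBilin_map_eq_covarianceBilin_multivariateGaussian hψ hψ₀])
    (hindep.comp₀ (fun _ => ψ) (fun i => (hY i).aemeasurable) fun i => by
      rw [(hY i).map_eq]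
      exact hψ.aemeasurable)
    fun i => (hX i).identDistrib (hX 0)
  simpa only [normalizedSum, hmean, smul_zero, sub_zero, Finset.sum_range, one_div] using hclt

lemma tendstoInDistribution_normalizedSum_of_isNegligible {ψ : 𝓨 → EuclideanSpace ℝ ι}
    (hψ : MemLp ψ 2 G) (hψ₀ : ∫ y, ψ y ∂G = 0)
    {lhat : (n : ℕ) → (Fin n → 𝓨) → Fin n → EuclideanSpace ℝ ι}
    (lhat_meas : ∀ n j, Measurable fun y => lhat n y j)
    (hl : IsNegligible G fun n y => (1 / √(n : ℝ)) * ‖∑ j, (lhat n y j - ψ (y j))‖)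
    (hY : ∀ i, HasLaw (Y i) G P) (hindep : iIndepFun Y P) :
    TendstoInDistribution (fun n ω => normalizedSum lhat n fun j : Fin n => Y j ω) atTop id
      (fun _ => P) (multivariateGaussian 0 (secondMoment G ψ)) := by
  refine tendstoInDistribution_of_tendstoInMeasure_sub _ _
    (tendstoInDistribution_normalizedSum_multivariateGaussian hψ hψ₀ hY hindep)
    (hl.tendstoInMeasure hY hindep fun n ω => ?_) fun n => ?_
  · rw [Pi.zero_apply, sub_zero, Pi.sub_apply, Pi.sub_apply, ← normalizedSum_sub, normalizedSum,
      norm_smul, Real.norm_of_nonneg (by positivity)]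
  · have hm : Measurable (normalizedSum lhat n) := by
      have := lhat_meas n
      unfold normalizedSum
      fun_prop
    exact hm.comp_aemeasurable (hasLaw_sample hY hindep n).aemeasurable

theorem tendstoInDistribution_dotProduct_normalizedSum_chiSquare {k : ℕ}
    {ψ : 𝓨 → EuclideanSpace ℝ (Fin k)} (hψ : MemLp ψ 2 G) (hψ₀ : ∫ y, ψ y ∂G = 0)
    (hS : (secondMoment G ψ).PosDef)
    {lhat : (n : ℕ) → (Fin n → 𝓨) → Fin n → EuclideanSpace ℝ (Fin k)}
    (lhat_meas : ∀ n j, Measurable fun y => lhat n y j)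
    {Lhat : (n : ℕ) → (Fin n → 𝓨) → Matrix (Fin k) (Fin k) ℝ}
    (Lhat_meas : ∀ n a b, Measurable fun y => Lhat n y a b)
    (hl : IsNegligible G fun n y => (1 / √(n : ℝ)) * ‖∑ j, (lhat n y j - ψ (y j))‖)
    (hL : IsNegligible G fun n y => √(∑ a, ∑ b, (Lhat n y a b - (secondMoment G ψ)⁻¹ a b) ^ 2))
    (hY : ∀ i, HasLaw (Y i) G P) (hindep : iIndepFun Y P) :
    TendstoInDistribution
      (fun n ω => (normalizedSum lhat n fun j : Fin n => Y j ω).ofLp ⬝ᵥ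
        Lhat n (fun j : Fin n => Y j ω) *ᵥ (normalizedSum lhat n fun j : Fin n => Y j ω).ofLp)
      atTop (id : ℝ → ℝ) (fun _ => P) (Deconvolution.chiSquare k) := by
  refine tendstoInDistribution_dotProduct_mulVec_chiSquare hS
    (tendstoInDistribution_normalizedSum_of_isNegligible hψ hψ₀ lhat_meas hl hY hindep)
    (fun n a b => (Lhat_meas n a b).comp_aemeasurable (hasLaw_sample hY hindep n).aemeasurable)
    (hL.tendstoInMeasure hY hindep fun n ω => le_of_eq ?_)
  simp [EuclideanSpace.norm_eq, Fintype.sum_prod_type]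

end Asymptotics

end EfficientScoreTest

namespace Deconvolution

open EfficientScoreTest

lemma IsDensity.isProbabilityMeasure {p : ℝ → ℝ} (hp : IsDensity p) :
    IsProbabilityMeasure (densityMeasure p) := by
  refine ⟨?_⟩
  rw [densityMeasure, withDensity_apply _ .univ, Measure.restrict_univ,
    ← ofReal_integral_eq_lintegral_ofReal hp.integrable (ae_of_all _ hp.nonneg),
    hp.integral_eq_one, ENNReal.ofReal_one]

namespace Model

variable {k m : ℕ} {M : Model k m} {θ : EuclideanSpace ℝ (Fin k)} {η : EuclideanSpace ℝ (Fin m)}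

lemma g_nonneg (hθ : θ ∈ M.Θ) (hη : η ∈ M.Λ) (y : ℝ) : 0 ≤ M.g θ η y :=
  integral_nonneg fun s => mul_nonneg ((M.isDensity_f θ hθ).nonneg s)
    ((M.isDensity_h η hη).nonneg _)

lemma measurable_g (hθ : θ ∈ M.Θ) (hη : η ∈ M.Λ) : Measurable (M.g θ η) := by
  have hf := (M.isDensity_f θ hθ).measurable
  have hh := (M.isDensity_h η hη).measurable
  have : Measurable fun p : ℝ × ℝ => M.f θ p.2 * M.h η (p.1 - p.2) := by fun_prop
  exact this.stronglyMeasurable.integral_prod_right'.measurable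

lemma conv_densityMeasure (hθ : θ ∈ M.Θ) (hη : η ∈ M.Λ) :
    densityMeasure (M.f θ) ∗ densityMeasure (M.h η) = M.G θ η := by
  have hf := M.isDensity_f θ hθ
  have hh := M.isDensity_h η hη
  rw [densityMeasure, densityMeasure, conv_withDensity_eq_lconvolution
    hf.measurable.ennreal_ofReal hh.measurable.ennreal_ofReal, G, densityMeasure]
  refine withDensity_congr_ae ?_
  filter_upwards [hf.integrable.ae_convolution_exists (.mul ℝ ℝ) hh.integrable] with y hy
  have hy : Integrable fun s => M.f θ s * M.h η (y - s) := hy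
  rw [g, ofReal_integral_eq_lintegral_ofReal hy
    (ae_of_all _ fun s => mul_nonneg (hf.nonneg s) (hh.nonneg _)), lconvolution_def]
  refine lintegral_congr fun s => ?_
  rw [ENNReal.ofReal_mul (hf.nonneg s), neg_add_eq_sub]

lemma isProbabilityMeasure_G (hθ : θ ∈ M.Θ) (hη : η ∈ M.Λ) : IsProbabilityMeasure (M.G θ η) := by
  have := (M.isDensity_f θ hθ).isProbabilityMeasure
  have := (M.isDensity_h η hη).isProbabilityMeasure
  rw [← conv_densityMeasure hθ hη]
  infer_instance

lemma hasLaw_add (hθ : θ ∈ M.Θ) (hη : η ∈ M.Λ) {Ω : Type*} {mΩ : MeasurableSpace Ω}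
    {P : Measure Ω} {X ε : Ω → ℝ} (hX : HasLaw X (densityMeasure (M.f θ)) P)
    (hε : HasLaw ε (densityMeasure (M.h η)) P) (hXε : IndepFun X ε P) :
    HasLaw (fun ω => X ω + ε ω) (M.G θ η) P := by
  have := (M.isDensity_f θ hθ).isProbabilityMeasure
  have := (M.isDensity_h η hη).isProbabilityMeasure
  rw [← conv_densityMeasure hθ hη]
  exact hXε.hasLaw_fun_add hX hε

lemma IsRegular.isRegularDensityFamily (hM : M.IsRegular) :
    IsRegularDensityFamily volume M.g (M.Θ ×ˢ M.Λ) where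
  isOpen := M.isOpen_Θ.prod M.isOpen_Λ
  measurable _ hx := measurable_g hx.1 hx.2
  nonneg _ hx := g_nonneg hx.1 hx.2
  isProbabilityMeasure _ hx := isProbabilityMeasure_G hx.1 hx.2
  contDiffOn := hM.A1
  memLp_score x hx := hM.A2 x.1 hx.1 x.2 hx.2
  continuousOn_info := hM.A3_continuous

end Model

end Deconvolution

open EfficientScoreTest in
open scoped Matrix in
theorem mainTheorem4_general {𝓨 κ : Type*} [MeasurableSpace 𝓨] [Fintype κ] [DecidableEq κ] {k : ℕ}
    (μ : Measure 𝓨) [SFinite μ] (g : EuclideanSpace ℝ (Fin k) → EuclideanSpace ℝ κ → 𝓨 → ℝ)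
    (U : Set (EuclideanSpace ℝ (Fin k) × EuclideanSpace ℝ κ)) (hg : IsRegularDensityFamily μ g U)
    (θ₀ : EuclideanSpace ℝ (Fin k)) (η₀ : EuclideanSpace ℝ κ) (h₀ : (θ₀, η₀) ∈ U)
    (G : Measure 𝓨) (hG : G = densityLaw μ (g θ₀ η₀))
    (hdet : IsUnit (secondMoment G (jointScore g θ₀ η₀)).det)
    (leff : 𝓨 → EuclideanSpace ℝ (Fin k))
    (hleff : leff = regressionResidual G (jointScore g θ₀ η₀))
    (lhat : (n : ℕ) → (Fin n → 𝓨) → Fin n → EuclideanSpace ℝ (Fin k))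
    (lhat_meas : ∀ n j, Measurable fun y => lhat n y j)
    (Lhat : (n : ℕ) → (Fin n → 𝓨) → Matrix (Fin k) (Fin k) ℝ)
    (Lhat_meas : ∀ n a b, Measurable fun y => Lhat n y a b)
    (hl : IsNegligible G fun n y => (1 / √(n : ℝ)) * ‖∑ j, (lhat n y j - leff (y j))‖)
    (hL : IsNegligible G fun n y => √(∑ a, ∑ b, (Lhat n y a b - (secondMoment G leff)⁻¹ a b) ^ 2))
    {Ω : Type*} [MeasurableSpace Ω] (P : Measure Ω) [IsProbabilityMeasure P] (Y : ℕ → Ω → 𝓨)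
    (hY : ∀ i, HasLaw (Y i) G P) (hindep : iIndepFun Y P) :
    TendstoInDistribution
      (fun n ω => (normalizedSum lhat n fun j : Fin n => Y j ω).ofLp ⬝ᵥ
        Lhat n (fun j : Fin n => Y j ω) *ᵥ (normalizedSum lhat n fun j : Fin n => Y j ω).ofLp)
      atTop (id : ℝ → ℝ) (fun _ => P) (Deconvolution.chiSquare k) := by
  subst hG hleff
  have := hg.isProbabilityMeasure _ h₀
  have hscore := hg.memLp_score _ h₀
  exact tendstoInDistribution_dotProduct_normalizedSum_chiSquare (memLp_regressionResidual hscore)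
    (integral_regressionResidual_eq_zero (hscore.integrable one_le_two)
      (hg.integral_jointScore_eq_zero h₀))
    (posDef_secondMoment_regressionResidual hscore hdet) lhat_meas Lhat_meas hl hL hY hindep

theorem mainTheorem4 {k m : ℕ} (M : Deconvolution.Model k m) (hM : M.IsRegular)
    (θ₀ : EuclideanSpace ℝ (Fin k)) (hθ₀ : θ₀ ∈ M.Θ)
    (η₀ : EuclideanSpace ℝ (Fin m)) (hη₀ : η₀ ∈ M.Λ)
    -- the estimated scores and the estimate of the inverse efficient information,
    -- both functions of the observations
    (lhat : (n : ℕ) → (Fin n → ℝ) → Fin n → EuclideanSpace ℝ (Fin k))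
    (lhat_meas : ∀ n j, Measurable fun y => lhat n y j)
    (Lhat : (n : ℕ) → (Fin n → ℝ) → Matrix (Fin k) (Fin k) ℝ)
    (Lhat_meas : ∀ n a b, Measurable fun y => Lhat n y a b)
    (hl : M.IsSufficientlyGood θ₀ η₀ lhat)
    (hL : M.IsConsistent θ₀ η₀ Lhat)
    -- the signals `X i` with density `f θ₀` (null hypothesis), the noises `ε i` with density `h η₀`
    {Ω : Type*} [MeasurableSpace Ω] (P : Measure Ω) [IsProbabilityMeasure P]
    (X ε : ℕ → Ω → ℝ)
    (hX : ∀ i, HasLaw (X i) (Deconvolution.densityMeasure (M.f θ₀)) P)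
    (hε : ∀ i, HasLaw (ε i) (Deconvolution.densityMeasure (M.h η₀)) P)
    (h_signal_noise : ∀ i, IndepFun (X i) (ε i) P)
    (h_indep : iIndepFun (fun i ω => (X i ω, ε i ω)) P) :
    TendstoInDistribution
      (fun n ω => Deconvolution.effScoreStatistic lhat Lhat n fun j : Fin n => X j ω + ε j ω)
      atTop (id : ℝ → ℝ) (fun _ => P) (Deconvolution.chiSquare k) := by
  exact mainTheorem4_general volume M.g (M.Θ ×ˢ M.Λ) hM.isRegularDensityFamily θ₀ η₀ ⟨hθ₀, hη₀⟩
    (M.G θ₀ η₀) rfl (hM.A3_nonsingular θ₀ hθ₀ η₀ hη₀) (M.effScore θ₀ η₀) rfl lhat lhat_meas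
    Lhat Lhat_meas hl hL P (fun i ω => X i ω + ε i ω)
    (fun i => Deconvolution.Model.hasLaw_add hθ₀ hη₀ (hX i) (hε i) (h_signal_noise i))
    (h_indep.comp (fun _ p => p.1 + p.2) fun _ => by fun_prop)
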